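/- Let $n\ge 2$ and $k\ge 2$ be integers and put $[k]=\{1,\dots,k\}$. An $n$-ary operation $F\colon [k]^n\to[k]$ is called *associative* if $$F(x_1,\ldots,x_{i-1},F(x_i,\ldots,x_{i+n-1}),x_{i+n},\ldots,x_{2n-1})=F(x_1,\ldots,x_i,F(x_{i+1},\ldots,x_{i+n}),x_{i+n+1},\ldots,x_{2n-1})$$ for all $x_1,\ldots,x_{2n-1}\in[k]$ and all $1\le i\le n-1$; *quasitrivial* if $F(x_1,\ldots,x_n)\in\{x_1,\ldots,x_n\}$ for all $x_1,\ldots,x_n\in[k]$; and *symmetric* if $F(x_1,\ldots,x_n)$ is invariant under every permutation of $x_1,\ldots,x_n$. An element $e\in[k]$ is *neutral* for $F$ if $F(e,\ldots,e,x,e,\ldots,e)=x$ for every $x\in[k]$ and every one of the $n$ possible positions of $x$. Let $qs^n(k)$ be the number of associative, quasitrivial, symmetric $n$-ary operations on $[k]$, and let $qs^n_1(k)$ and $qs^n_2(k)$ be the numbers of those that have exactly one, respectively exactly two, neutral elements. Then $$qs^n_1(k)=qs^2(k)=k!.$$ Moreover, if $n$ is odd, then $$qs^n_2(k)=\frac{k!}{2}\qquad\text{and}\qquad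 qs^n(k)=\frac{3\,k!}{2}.$$ -/

import Mathlib

open scoped Nat

/-- An `n`-ary operation `F : Xⁿ → X`. -/
abbrev NaryOp (n : ℕ) (X : Type*) := (Fin n → X) → X

namespace NaryOp

variable {n : ℕ} {X : Type*}

/-- The element `F(x₁, …, x_i, F(x_{i+1}, …, x_{i+n}), x_{i+n+1}, …, x_{2n-1})`:
the inner application of `F` is the entry with (0-based) index `i` of the outer one. -/
def nested (F : NaryOp n X) (x : Fin (2 * n - 1) → X) (i : Fin n) : X :=
  F fun j : Fin n =>
    if j < i then x ⟨j, by omega⟩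
    else if j = i then F fun l : Fin n => x ⟨i + l, by omega⟩
    else x ⟨j + n - 1, by omega⟩

/-- Associativity: two consecutive positions of the inner application give the same result. -/
def IsAssociative (F : NaryOp n X) : Prop :=
  ∀ (x : Fin (2 * n - 1) → X) (i j : Fin n), (j : ℕ) = (i : ℕ) + 1 →
    F.nested x i = F.nested x j

/-- Quasitriviality: `F(x₁, …, x_n) ∈ {x₁, …, x_n}`. -/
def IsQuasitrivial (F : NaryOp n X) : Prop :=
  ∀ x : Fin n → X, F x ∈ Set.range x

/-- Symmetry: `F(x₁, …, x_n)` is invariant under any permutation of `x₁, …, x_n`. -/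
def IsSymmetric (F : NaryOp n X) : Prop :=
  ∀ (σ : Equiv.Perm (Fin n)) (x : Fin n → X), F (x ∘ σ) = F x

/-- `e` is a neutral element of `F`: `F(e, …, e, x, e, …, e) = x` for every `x` and every
position of `x`. -/
def IsNeutral (F : NaryOp n X) (e : X) : Prop :=
  ∀ (x : X) (i : Fin n), F (Function.update (fun _ => e) i x) = x

/-- The set of associative, quasitrivial, symmetric `n`-ary operations on `X`. -/
def aqsOps (n : ℕ) (X : Type*) : Set (NaryOp n X) :=
  {F | F.IsAssociative ∧ F.IsQuasitrivial ∧ F.IsSymmetric}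

/-- The number of associative, quasitrivial, symmetric `n`-ary operations on a set with `k`
elements. -/
noncomputable def qs (n k : ℕ) : ℕ := (aqsOps n (Fin k)).ncard

/-- The number of associative, quasitrivial, symmetric `n`-ary operations on a set with `k`
elements that have exactly `m` neutral elements. -/
noncomputable def qsNeutral (m n k : ℕ) : ℕ :=
  {F ∈ aqsOps n (Fin k) | {e | F.IsNeutral e}.ncard = m}.ncard

end NaryOp

/-! If `F` has a neutral element `e`, then `x * y = F(x, y, e, …, e)` is a commutative monoid with
unit `e`, and `F` is its `n`-fold product (`IsMultisetForm.exists_commMonoid`). Quasitriviality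
forces this monoid to be a chain under `max` with unit at the bottom, except that the second element
may square to the unit, which requires `n` odd (`exists_mulEquiv_twistedChain`). A neutral element
always exists, because the relation "`F(y, x, …, x) = y`" is total and transitive on a finite set
(`IsMultisetForm.exists_neutral`).

These chains have no nontrivial automorphism, so for each type the pairs `(F, e)` with `e` neutral
correspond to the `k!` bijections onto the chain. In the plain chain only the unit is neutral,
giving `k!` operations; in the twisted one the second element is neutral too, since its even power
`n - 1` is the unit, giving `k!/2`. -/

/-! ### The model monoids -/

/-- The chain `0 < 1 < ⋯ < m + 1` with the operation `max`, except that `1 * 1 = 0` if `t` holds. -/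
def TwistedChain (_t : Bool) (m : ℕ) : Type := Fin (m + 2)

namespace TwistedChain

variable {t : Bool} {m : ℕ}

instance : Fintype (TwistedChain t m) := inferInstanceAs (Fintype (Fin (m + 2)))

instance : DecidableEq (TwistedChain t m) := inferInstanceAs (DecidableEq (Fin (m + 2)))

instance : LinearOrder (TwistedChain t m) := inferInstanceAs (LinearOrder (Fin (m + 2)))

/-- The position of an element in the chain. -/
def val (x : TwistedChain t m) : ℕ := Fin.val x

theorem val_injective : Function.Injective (val : TwistedChain t m → ℕ) := Fin.val_injective

theorem le_iff_val {x y : TwistedChain t m} : x ≤ y ↔ x.val ≤ y.val := Iff.rfl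

instance : One (TwistedChain t m) := ⟨(0 : Fin (m + 2))⟩

/-- The second smallest element of the chain. -/
def second : TwistedChain t m := (1 : Fin (m + 2))

instance : Mul (TwistedChain t m) :=
  ⟨fun x y => if t = true ∧ x.val = 1 ∧ y.val = 1 then 1 else max x y⟩

theorem val_one : (1 : TwistedChain t m).val = 0 := rfl

theorem val_second : (second : TwistedChain t m).val = 1 := rfl

theorem val_max (x y : TwistedChain t m) : (max x y).val = max x.val y.val := by
  rcases le_total x y with h | h
  · rw [max_eq_right h, max_eq_right (le_iff_val.1 h)]
  · rw [max_eq_left h, max_eq_left (le_iff_val.1 h)]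

theorem val_mul (x y : TwistedChain t m) :
    (x * y).val = if t = true ∧ x.val = 1 ∧ y.val = 1 then 0 else max x.val y.val := by
  change (if t = true ∧ x.val = 1 ∧ y.val = 1 then 1 else max x y).val = _
  split_ifs
  · rfl
  · exact val_max x y

instance : CommMonoid (TwistedChain t m) where
  mul_assoc x y z := by
    apply val_injective
    simp only [val_mul]
    cases t <;> grind
  mul_comm x y := by
    apply val_injective
    simp only [val_mul]
    grind
  one_mul x := by
    apply val_injective
    simp [val_mul, val_one]
  mul_one x := by
    apply val_injective
    simp [val_mul, val_one]

theorem mul_mem (x y : TwistedChain t m) : x * y = x ∨ x * y = y ∨ x * y = 1 := by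
  simp only [← val_injective.eq_iff, val_mul, val_one]
  grind

theorem second_ne_one : (second : TwistedChain t m) ≠ 1 := by
  simp [← val_injective.eq_iff, val_second, val_one]

theorem second_mul_second : (second * second : TwistedChain true m) = 1 := by
  simp [← val_injective.eq_iff, val_mul, val_second, val_one]

theorem eq_one_of_mul_eq_one {x y : TwistedChain t m} (h : x * y = 1) :
    x = 1 ∨ (t = true ∧ x = second) := by
  simp only [← val_injective.eq_iff, val_mul, val_second, val_one] at *
  grind

theorem le_iff_mul {x y : TwistedChain t m} : x ≤ y ↔ x = y ∨ x * y = y := by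
  simp only [← val_injective.eq_iff, val_mul, le_iff_val]
  grind

theorem second_pow_even {r : ℕ} (hr : Even r) : (second : TwistedChain true m) ^ r = 1 := by
  obtain ⟨s, rfl⟩ := hr
  rw [← two_mul, pow_mul, pow_two, second_mul_second, one_pow]

theorem second_pow_odd {r : ℕ} (hr : Odd r) : (second : TwistedChain true m) ^ r = second := by
  obtain ⟨s, rfl⟩ := hr
  rw [pow_succ, second_pow_even (even_two_mul s), one_mul]

theorem eq_one_of_pow_eq_one {x : TwistedChain t m} {r : ℕ} (h : x ^ (r + 1) = 1) :
    x = 1 ∨ (t = true ∧ x = second) := by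
  rw [pow_succ'] at h
  exact eq_one_of_mul_eq_one h

theorem prod_mem_or {ι : Type*} {s : Finset ι} (hs : s.Nonempty) (x : ι → TwistedChain t m) :
    ∏ i ∈ s, x i ∈ Set.range x ∨ ∏ i ∈ s, x i = 1 := by
  classical
  induction hs using Finset.Nonempty.cons_induction with
  | singleton a => exact Or.inl ⟨a, by simp⟩
  | cons a s ha hs ih =>
    rw [Finset.prod_cons]
    rcases mul_mem (x a) (∏ i ∈ s, x i) with h | h | h
    · rw [h]; exact Or.inl ⟨a, rfl⟩
    · rw [h]; exact ih
    · exact Or.inr h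

/-- A product that is not one of its factors equals `1`; then every factor divides `1` without being
`1`, so all are `second`, whose odd powers are `second`. -/
theorem prod_mem_range {n : ℕ} (hn : n ≠ 0) (ht : t = true → Odd n)
    (x : Fin n → TwistedChain t m) : ∏ i, x i ∈ Set.range x := by
  have : NeZero n := ⟨hn⟩
  rcases prod_mem_or (s := Finset.univ) ⟨(0 : Fin n), Finset.mem_univ _⟩ x with h | h
  · exact h
  by_cases h1 : ∃ i, x i = 1
  · obtain ⟨i, hi⟩ := h1
    exact ⟨i, hi.trans h.symm⟩
  push Not at h1
  have hx : ∀ i, t = true ∧ x i = second := by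
    intro i
    rw [← Finset.mul_prod_erase _ _ (Finset.mem_univ i)] at h
    exact (eq_one_of_mul_eq_one h).resolve_left (h1 i)
  obtain rfl := (hx 0).1
  refine ⟨0, ?_⟩
  simp_rw [fun i => (hx i).2]
  rw [Finset.prod_const, Finset.card_univ, Fintype.card_fin, second_pow_odd (ht rfl)]

/-- The order is definable from the product (`le_iff_mul`), and a finite chain is rigid. -/
theorem mulEquiv_eq_refl (g : TwistedChain t m ≃* TwistedChain t m) (x : TwistedChain t m) :
    g x = x := by
  let o : TwistedChain t m ≃o TwistedChain t m :=
    { g.toEquiv with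
      map_rel_iff' := by
        intro a b
        change g a ≤ g b ↔ a ≤ b
        rw [le_iff_mul, le_iff_mul, ← map_mul, g.injective.eq_iff, g.injective.eq_iff] }
  have : o = OrderIso.refl _ := Subsingleton.elim _ _
  exact congrArg (fun q : TwistedChain t m ≃o TwistedChain t m => q x) this

end TwistedChain

/-! ### Classification of the monoids -/

/-- A finite commutative monoid in which `n`-fold products are among their factors is a
twisted chain. -/
theorem exists_mulEquiv_twistedChain {M : Type*} [CommMonoid M] [Fintype M] {m p : ℕ}
    (hM : Fintype.card M = m + 2) (hq : ∀ x : Fin (p + 2) → M, ∏ i, x i ∈ Set.range x) :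
    ∃ t : Bool, (t = true → Odd (p + 2)) ∧ Nonempty (M ≃* TwistedChain t m) := by
  classical
  have h2 : ∀ x y : M, x * y = x ∨ x * y = y ∨ x * y = 1 := by
    intro x y
    obtain ⟨i, hi⟩ := hq (Fin.cons x (Fin.cons y fun _ => 1))
    simp only [Fin.prod_univ_succ, Fin.cons_zero, Fin.cons_succ, Finset.prod_const_one,
      mul_one] at hi
    rw [← hi]
    refine Fin.cases ?_ (fun i => Fin.cases ?_ (fun i => ?_) i) i <;> simp
  have hpow : ∀ x : M, x ^ (p + 2) = x := by
    intro x
    obtain ⟨i, hi⟩ := hq fun _ => x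
    simpa using hi.symm
  have hidem : ∀ x : M, x * x ≠ 1 → x * x = x := fun x h => by
    have := h2 x x
    tauto
  have hne : ∀ x y : M, x ≠ y → x * y = x ∨ x * y = y := by
    intro x y hxy
    rcases h2 x y with h | h | h
    · exact Or.inl h
    · exact Or.inr h
    · by_cases hx : x * x = 1
      -- If `x * x = 1`, then `y = x * x * y = x`.
      · exact absurd (by rw [← one_mul y, ← hx, mul_assoc, h, mul_one]) hxy
      · have h3 : x = 1 := by
          rw [← mul_one x, ← h, ← mul_assoc, hidem x hx]
        left; rw [h, h3]
  let L : LinearOrder M :=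
    { le := fun x y => x = y ∨ x * y = y
      le_refl := fun x => Or.inl rfl
      le_trans := by
        rintro x y z (rfl | hxy) (rfl | hyz)
        · exact Or.inl rfl
        · exact Or.inr hyz
        · exact Or.inr hxy
        · right
          rw [← hyz, ← mul_assoc, hxy]
      le_antisymm := by
        rintro x y (h | hxy) (h' | hyx)
        · exact h
        · exact h
        · exact h'.symm
        · rw [← hyx, mul_comm, hxy]
      le_total := by
        intro x y
        by_cases hxy : x = y
        · exact Or.inl (Or.inl hxy)
        · rcases hne x y hxy with h | h
          · right; right; rwa [mul_comm]
          · exact Or.inl (Or.inr h)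
      toDecidableLE := Classical.decRel _ }
  have hle : ∀ x y : M, x ≤ y ↔ x = y ∨ x * y = y := fun x y => Iff.rfl
  have hmax : ∀ x y : M, x ≠ y → x * y = max x y := by
    intro x y hxy
    rcases hne x y hxy with h | h
    · rw [h, max_eq_left ((hle y x).2 (Or.inr (by rwa [mul_comm])))]
    · rw [h, max_eq_right ((hle x y).2 (Or.inr h))]
  obtain ⟨g⟩ : Nonempty (M ≃o Fin (m + 2)) := ⟨(Fintype.orderIsoFinOfCardEq M hM).symm⟩
  have hgmax : ∀ x y : M, (g (max x y) : ℕ) = max (g x : ℕ) (g y : ℕ) := by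
    intro x y
    rw [g.monotone.map_max]
    exact TwistedChain.val_max (t := true) (g x) (g y)
  have hg1 : g 1 = 0 := by
    apply le_antisymm _ (Fin.zero_le _)
    rw [← g.le_symm_apply]
    exact (hle _ _).2 (Or.inr (one_mul _))
  have hg0 : ∀ x, (g x : ℕ) = 0 → x = 1 := fun x hx =>
    g.injective (by rw [hg1]; exact Fin.ext hx)
  -- If `c` is the second element and `a * c = a`, then `c = a * a * c = a * a = 1`, which is
  -- impossible.
  have hga : ∀ a : M, a ≠ 1 → a * a = 1 → (g a : ℕ) = 1 := by
    intro a ha1 ha2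
    have h0 : (g a : ℕ) ≠ 0 := fun h => ha1 (hg0 a h)
    have h1 : g a ≤ 1 := by
      rw [← g.le_symm_apply, hle]
      by_contra hcon
      push Not at hcon
      have h3 := (hne a (g.symm 1) hcon.1).resolve_right hcon.2
      have h4 : g.symm 1 = 1 := by
        rw [← one_mul (g.symm 1), ← ha2, mul_assoc, h3]
      have h5 := congrArg g h4
      rw [hg1, OrderIso.apply_symm_apply] at h5
      exact absurd h5 (by simp)
    have h2 : (g a : ℕ) ≤ 1 := h1
    omega
  have key : ∀ x y : M, (g (x * y) : ℕ) =
      if decide (∃ a : M, a ≠ 1 ∧ a * a = 1) = true ∧ (g x : ℕ) = 1 ∧ (g y : ℕ) = 1 then 0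
      else max (g x : ℕ) (g y : ℕ) := by
    intro x y
    by_cases hxy : x = y
    · subst hxy
      by_cases hx : x * x = 1
      · by_cases hx1 : x = 1
        · subst hx1; simp [hg1]
        · rw [if_pos ⟨decide_eq_true ⟨x, hx1, hx⟩, hga x hx1 hx, hga x hx1 hx⟩]
          rw [hx, hg1]
          rfl
      · rw [hidem x hx, if_neg, max_self]
        rintro ⟨h, h1, -⟩
        obtain ⟨a, ha1, ha2⟩ := of_decide_eq_true h
        have : g x = g a := Fin.ext (h1.trans (hga a ha1 ha2).symm)
        exact hx (g.injective this ▸ ha2)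
    · rw [hmax x y hxy, hgmax, if_neg]
      rintro ⟨-, h1, h2⟩
      exact hxy (g.injective (Fin.ext (h1.trans h2.symm)))
  refine ⟨decide (∃ a : M, a ≠ 1 ∧ a * a = 1), ?_, ⟨?_⟩⟩
  · intro h
    obtain ⟨a, ha1, ha2⟩ := of_decide_eq_true h
    by_contra hodd
    obtain ⟨r, hr⟩ := Nat.not_odd_iff_even.1 hodd
    apply ha1
    rw [← hpow a, hr, ← two_mul, pow_mul, pow_two, ha2, one_pow]
  · refine MulEquiv.mk' (g.toEquiv : M ≃ TwistedChain _ m) fun x y => ?_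
    apply TwistedChain.val_injective
    rw [TwistedChain.val_mul]
    exact key x y

/-! ### Operations coming from monoids -/

namespace NaryOp

variable {X : Type*} {p : ℕ}

/-- The operation on `X` obtained from the iterated product of a commutative monoid in bijection
with `X`. -/
def ofEquiv (n : ℕ) {M : Type*} [CommMonoid M] (σ : X ≃ M) : NaryOp n X :=
  fun x => σ.symm (∏ i, σ (x i))

theorem prod_nested {M : Type*} [CommMonoid M] {n : ℕ} (x : Fin (2 * n - 1) → M) (i : Fin n) :
    nested (fun y => ∏ j, y j) x i = ∏ j, x j := by
  let y : ℕ → M := fun j => if h : j < 2 * n - 1 then x ⟨j, h⟩ else 1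
  have hy : ∀ j (h : j < 2 * n - 1), x ⟨j, h⟩ = y j := fun j h => by simp [y, h]
  have hR : ∏ j, x j = ∏ j ∈ Finset.range (2 * n - 1), y j := by
    rw [← Fin.prod_univ_eq_prod_range]
    exact Finset.prod_congr rfl fun j _ => hy j j.2
  have hL : nested (fun y => ∏ j, y j) x i = ∏ j ∈ Finset.range n,
      (if j < (i : ℕ) then y j else if j = i then ∏ l ∈ Finset.range n, y (i + l)
        else y (j + n - 1)) := by
    rw [← Fin.prod_univ_eq_prod_range, ← Fin.prod_univ_eq_prod_range]
    refine Finset.prod_congr rfl fun j _ => ?_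
    simp only [hy, Fin.lt_def, Fin.ext_iff]
  rw [hL, hR]
  -- `r` counts the outer arguments to the right of the inner block.
  obtain ⟨r, hr⟩ : ∃ r, n = i + (1 + r) := ⟨n - 1 - i, by omega⟩
  have e1 : 2 * n - 1 = i + (n + r) := by omega
  rw [e1, Finset.prod_range_add y, Finset.prod_range_add (fun l => y (i + l))]
  have hsplit : ∀ f : ℕ → M, ∏ j ∈ Finset.range n, f j =
      (∏ j ∈ Finset.range i, f j) * (f i * ∏ j ∈ Finset.range r, f (i + (1 + j))) := by
    intro f
    rw [show Finset.range n = Finset.range (i + (1 + r)) from congrArg _ hr,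
      Finset.prod_range_add, Finset.prod_range_add, Finset.prod_range_one, add_zero]
  rw [hsplit fun j => _]
  congr 1
  · refine Finset.prod_congr rfl fun j hj => ?_
    rw [if_pos (Finset.mem_range.1 hj)]
  · congr 1
    · simp
    · refine Finset.prod_congr rfl fun j _ => ?_
      rw [if_neg (by omega), if_neg (by omega)]
      congr 1
      omega

variable {n : ℕ} {M : Type*} [CommMonoid M] (σ : X ≃ M)

theorem ofEquiv_nested (x : Fin (2 * n - 1) → X) (i : Fin n) :
    (ofEquiv n σ).nested x i = σ.symm (∏ j, σ (x j)) := by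
  rw [← prod_nested (fun j => σ (x j)) i]
  simp only [nested, ofEquiv]
  congr 1
  refine Finset.prod_congr rfl fun j _ => ?_
  split_ifs <;> simp

theorem isAssociative_ofEquiv : (ofEquiv n σ).IsAssociative := fun x i j _ => by
  rw [ofEquiv_nested, ofEquiv_nested]

theorem isSymmetric_ofEquiv : (ofEquiv n σ).IsSymmetric := fun τ x => by
  simp only [ofEquiv, Function.comp_apply]
  rw [Equiv.prod_comp τ fun i => σ (x i)]

theorem isQuasitrivial_ofEquiv (h : ∀ x : Fin n → M, ∏ i, x i ∈ Set.range x) :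
    (ofEquiv n σ).IsQuasitrivial := fun x => by
  obtain ⟨i, hi⟩ := h fun i => σ (x i)
  exact ⟨i, by simp [ofEquiv, ← hi]⟩

theorem isNeutral_ofEquiv {e : X} : (ofEquiv (p + 2) σ).IsNeutral e ↔ σ e ^ (p + 1) = 1 := by
  have key : ∀ (x : X) (i : Fin (p + 2)),
      ofEquiv (p + 2) σ (Function.update (fun _ => e) i x) = σ.symm (σ x * σ e ^ (p + 1)) := by
    intro x i
    simp only [ofEquiv]
    have : ∀ j, σ (Function.update (fun _ => e) i x j) =
        Function.update (fun _ => σ e) i (σ x) j := fun j => by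
      simp only [Function.update_apply]; split_ifs <;> rfl
    simp_rw [this]
    rw [Finset.prod_update_of_mem (Finset.mem_univ i)]
    simp [Finset.card_sdiff]
  constructor
  · intro h
    have := h (σ.symm 1) 0
    rw [key, σ.symm.injective.eq_iff] at this
    simpa using this
  · intro h x i
    rw [key, h, mul_one, Equiv.symm_apply_apply]

/-- The binary operation is recovered from the `n`-ary one. -/
theorem ofEquiv_cons_cons (a b : X) :
    ofEquiv (p + 2) σ (Fin.cons a (Fin.cons b fun _ => σ.symm 1)) = σ.symm (σ a * σ b) := by
  simp [ofEquiv, Fin.prod_univ_succ]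

end NaryOp

/-! ### Symmetric operations as functions of multisets -/

theorem exists_perm_of_map_univ_eq {ι X : Type*} [Fintype ι] {x y : ι → X}
    (h : Finset.univ.val.map x = Finset.univ.val.map y) : ∃ σ : Equiv.Perm ι, y ∘ σ = x := by
  classical
  have hc : ∀ a, Nonempty ({i // x i = a} ≃ {i // y i = a}) := by
    intro a
    refine ⟨Fintype.equivOfCardEq ?_⟩
    have := congrArg (Multiset.count a) h
    rw [Multiset.count_map, Multiset.count_map] at this
    rw [Fintype.card_subtype, Fintype.card_subtype]
    simp only [eq_comm (a := a)] at this
    exact this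
  exact ⟨Equiv.ofFiberEquiv fun a => (hc a).some, funext fun i => Equiv.ofFiberEquiv_map _ i⟩

theorem Multiset.exists_eq_map_univ {X : Type*} {n : ℕ} (s : Multiset X) (hs : card s = n) :
    ∃ x : Fin n → X, s = Finset.univ.val.map x := by
  obtain ⟨l, rfl⟩ := Quot.exists_rep s
  subst hs
  exact ⟨l.get, (congrArg _ (List.ofFn_get l).symm).trans (Fin.univ_val_map _).symm⟩

theorem Fin.map_cons_univ_val {X : Type*} {n : ℕ} (a : X) (x : Fin n → X) :
    Finset.univ.val.map (Fin.cons a x : Fin (n + 1) → X) = a ::ₘ Finset.univ.val.map x := by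
  simp only [Fin.univ_val_map, List.ofFn_cons, Multiset.cons_coe]

theorem Fin.map_snoc_univ_val {X : Type*} {n : ℕ} (a : X) (x : Fin n → X) :
    Finset.univ.val.map (Fin.snoc x a : Fin (n + 1) → X) = a ::ₘ Finset.univ.val.map x := by
  rw [Fin.univ_val_map, Fin.univ_val_map, Multiset.cons_coe, List.ofFn_succ', Multiset.coe_eq_coe]
  simp [List.concat_eq_append]

namespace NaryOp

variable {X : Type*} {p : ℕ}

theorem IsSymmetric.exists_multiset [Nonempty X] {n : ℕ} {F : NaryOp n X} (hF : F.IsSymmetric) :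
    ∃ f : Multiset X → X, ∀ x, F x = f (Finset.univ.val.map x) := by
  classical
  refine ⟨fun s => if h : ∃ x : Fin n → X, s = Finset.univ.val.map x then F h.choose
    else Classical.arbitrary X, fun x => ?_⟩
  have h : ∃ y : Fin n → X, Finset.univ.val.map x = Finset.univ.val.map y := ⟨x, rfl⟩
  obtain ⟨σ, hσ⟩ := exists_perm_of_map_univ_eq h.choose_spec
  change F x = dite _ _ _
  rw [dif_pos h, ← hF σ h.choose, hσ]

/-- Associativity lets the first argument of an inner application be exchanged with an argument
of the outer one. -/
theorem IsAssociative.exchange {F : NaryOp (p + 2) X} (hF : F.IsAssociative) (a b : X)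
    (α : Fin (p + 1) → X) (β : Fin p → X) :
    F (Fin.cons (F (Fin.cons a α)) (Fin.cons b β)) =
      F (Fin.cons a (Fin.cons (F (Fin.snoc α b)) β)) := by
  -- The sequence `a, α, b, β` of length `2p + 3`, continued by `b`. Truncated subtraction sends `j
  -- = p + 2` to index `0` of `β`, hence the extra test.
  let y : ℕ → X := fun j => if j = 0 then a else if h : j - 1 < p + 1 then α ⟨j - 1, h⟩
    else if h : j - (p + 3) < p then (if j = p + 2 then b else β ⟨j - (p + 3), h⟩) else b
  have h0 : y 0 = a := rfl
  have hα : ∀ j (h : j < p + 1), y (j + 1) = α ⟨j, h⟩ := fun j h => by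
    simp only [y]
    rw [if_neg (by omega), dif_pos (by omega)]
    rfl
  have hb : y (p + 2) = b := by simp [y]
  have hβ : ∀ j (h : j < p), y (j + (p + 3)) = β ⟨j, h⟩ := fun j h => by
    simp only [y]
    rw [if_neg (by omega), dif_neg (by omega), dif_pos (by omega), if_neg (by omega)]
    congr 2
    omega
  have key := hF (fun j => y j) 0 1 rfl
  have e1 : (fun l : Fin (p + 2) => y (0 + l)) = Fin.cons a α := by
    funext l
    refine Fin.cases ?_ (fun l => ?_) l
    · simp [h0]
    · rw [Fin.cons_succ, zero_add, Fin.val_succ, hα _ l.2]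
  have e2 : (fun l : Fin (p + 2) => y (1 + l)) = Fin.snoc α b := by
    funext l
    refine Fin.lastCases ?_ (fun l => ?_) l
    · simp only [Fin.snoc_last, Fin.val_last]
      rw [← hb]; congr 1; omega
    · simp only [Fin.snoc_castSucc, Fin.val_castSucc]
      rw [add_comm, hα _ l.2]
  have l1 : F.nested (fun j => y j) 0 = F (Fin.cons (F (Fin.cons a α)) (Fin.cons b β)) := by
    rw [← e1]
    simp only [nested]
    congr 1
    funext j
    refine Fin.cases ?_ (fun j => Fin.cases ?_ (fun j => ?_) j) j
    · simp
    · simp only [Fin.cons_succ, Fin.cons_zero]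
      rw [if_neg (by simp), if_neg (by simp), ← hb]
      congr 1
      simp
    · simp only [Fin.cons_succ]
      rw [if_neg (by simp), if_neg (by simp), ← hβ _ j.2]
      congr 1
      simp
      omega
  have l2 : F.nested (fun j => y j) 1 = F (Fin.cons a (Fin.cons (F (Fin.snoc α b)) β)) := by
    rw [← e2]
    simp only [nested]
    congr 1
    funext j
    refine Fin.cases ?_ (fun j => Fin.cases ?_ (fun j => ?_) j) j
    · simp [h0]
    · simp
    · simp only [Fin.cons_succ]
      rw [if_neg (by simp [Fin.lt_def]), if_neg (by simp [Fin.ext_iff]), ← hβ _ j.2]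
      congr 1
      simp
      omega
  rw [← l1, ← l2, key]

/-- A symmetric associative quasitrivial operation of arity `p + 2`, seen as a function of the
multiset of its arguments. -/
structure IsMultisetForm (p : ℕ) (f : Multiset X → X) : Prop where
  mem : ∀ s, Multiset.card s = p + 2 → f s ∈ s
  exchange : ∀ a b A B, Multiset.card A = p + 1 → Multiset.card B = p →
    f (f (a ::ₘ A) ::ₘ b ::ₘ B) = f (f (b ::ₘ A) ::ₘ a ::ₘ B)

theorem exists_isMultisetForm [Nonempty X] {F : NaryOp (p + 2) X} (hF : F ∈ aqsOps (p + 2) X) :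
    ∃ f : Multiset X → X, IsMultisetForm p f ∧ ∀ x, F x = f (Finset.univ.val.map x) := by
  obtain ⟨ha, hq, hs⟩ := hF
  obtain ⟨f, hf⟩ := hs.exists_multiset
  refine ⟨f, ⟨fun s hs => ?_, fun a b A B hA hB => ?_⟩, hf⟩
  · obtain ⟨x, rfl⟩ := s.exists_eq_map_univ hs
    obtain ⟨i, hi⟩ := hq x
    rw [← hf, ← hi]
    exact Multiset.mem_map_of_mem _ (Finset.mem_univ_val i)
  · obtain ⟨α, rfl⟩ := A.exists_eq_map_univ hA
    obtain ⟨β, rfl⟩ := B.exists_eq_map_univ hB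
    have := ha.exchange a b α β
    simp only [hf, Fin.map_cons_univ_val, Fin.map_snoc_univ_val] at this
    rw [this, Multiset.cons_swap]

/-! ### Existence of a neutral element and the associated monoid -/

namespace IsMultisetForm

open Multiset

variable {f : Multiset X → X} (hf : IsMultisetForm p f)

include hf

theorem replicate_self (x : X) : f (replicate (p + 2) x) = x :=
  eq_of_mem_replicate (hf.mem _ (card_replicate _ _))

/-- Iterating `exchange` swaps whole blocks of equal size between the inner and outer application.
-/
theorem exchange_add (D D' : Multiset X) (h : card D = card D') (C E : Multiset X)
    (hC : card C + card D = p + 2) (hE : card E + card D = p + 1) :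
    f (f (C + D) ::ₘ (E + D')) = f (f (C + D') ::ₘ (E + D)) := by
  induction D using Multiset.induction generalizing D' C E with
  | empty =>
    rw [card_zero, eq_comm, card_eq_zero] at h
    rw [h]
  | cons d D ih =>
    have hpos : 0 < card D' := by rw [← h, card_cons]; omega
    obtain ⟨d', hd'⟩ := card_pos_iff_exists_mem.1 hpos
    obtain ⟨D', rfl⟩ := exists_cons_of_mem hd'
    simp only [card_cons] at h hC hE
    have := ih D' (by omega) (d' ::ₘ C) (d ::ₘ E) (by simp; omega) (by simp; omega)
    rw [add_cons, add_cons, hf.exchange d d' _ _ (by simp; omega) (by simp; omega),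
      ← cons_add, ← cons_add, this, cons_add, cons_add, add_cons, add_cons]

/-- The inner values on `y, x, …, x` and on `x, …, x` are both `x`, so `exchange` trades one outer
`x` for a `y` without changing the value. -/
theorem eq_left_of_absorb {x y : X} (h : f (y ::ₘ replicate (p + 1) x) = x) (N : ℕ) :
    ∀ M, M + N = p → f (replicate (M + 1) x + replicate (N + 1) y) = x := by
  induction N with
  | zero =>
    rintro M rfl
    rw [zero_add, replicate_one, add_comm, singleton_add]
    exact h
  | succ N ih =>
    intro M hM
    have h1 := ih (M + 1) (by omega)
    have h2 := hf.exchange y x (replicate (p + 1) x) (replicate M x + replicate (N + 1) y)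
      (by simp) (by simp; omega)
    rw [h, ← replicate_succ, hf.replicate_self, ← cons_add, ← cons_add, ← replicate_succ,
      ← replicate_succ, h1, ← add_cons, ← replicate_succ, ← cons_add, ← replicate_succ] at h2
    exact h2.symm

theorem total (x y : X) :
    f (y ::ₘ replicate (p + 1) x) = y ∨ f (x ::ₘ replicate (p + 1) y) = x := by
  have := hf.mem (y ::ₘ replicate (p + 1) x) (by simp)
  rcases mem_cons.1 this with h | h
  · exact Or.inl h
  · right
    have := hf.eq_left_of_absorb (eq_of_mem_replicate h) p 0 (by simp)
    rwa [zero_add, replicate_one, singleton_add] at this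

theorem trans {x y z : X} (hxy : f (y ::ₘ replicate (p + 1) x) = y)
    (hyz : f (z ::ₘ replicate (p + 1) y) = z) : f (z ::ₘ replicate (p + 1) x) = z := by
  -- Swapping the blocks `x, …, x` and `z, y, …, y` around the inner `y` gives `F(F(y, x, …, x), z,
  -- y, …, y) = F(F(y, z, y, …, y), x, …, x)`.
  have := hf.exchange_add (replicate (p + 1) x) (z ::ₘ replicate p y) (by simp) {y} 0
    (by simp; omega) (by simp)
  rw [singleton_add, singleton_add, zero_add, zero_add, hxy, cons_swap y z,
    ← replicate_succ, hyz] at this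
  exact this.symm

theorem exists_neutral [Finite X] [Nonempty X] :
    ∃ e, ∀ x, f (x ::ₘ replicate (p + 1) e) = x := by
  let r : X → X → Prop := fun y x => f (y ::ₘ replicate (p + 1) x) = y
  have : IsTrans X r := ⟨fun a b c hab hbc => hf.trans hbc hab⟩
  have hd : Directed r id := by
    intro x y
    rcases hf.total x y with h | h
    · exact ⟨x, by simpa [r] using hf.replicate_self x, h⟩
    · exact ⟨y, h, by simpa [r] using hf.replicate_self y⟩
  exact hd.finite_le id

theorem exists_commMonoid {e : X} (he : ∀ x, f (x ::ₘ replicate (p + 1) e) = x) :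
    ∃ I : CommMonoid X, I.one = e ∧ ∀ s : Multiset X, card s = p + 2 → f s = s.prod := by
  have hone : ∀ x, f (x ::ₘ e ::ₘ replicate p e) = x := fun x => by
    rw [← replicate_succ, he]
  let I : CommMonoid X :=
    { mul := fun x y => f (x ::ₘ y ::ₘ replicate p e)
      one := e
      mul_comm := fun x y => congrArg f (cons_swap _ _ _)
      mul_one := hone
      one_mul := fun x => (congrArg f (cons_swap _ _ _)).trans (hone x)
      mul_assoc := fun x y z => by
        change f (f (x ::ₘ y ::ₘ replicate p e) ::ₘ z ::ₘ replicate p e) =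
          f (x ::ₘ f (y ::ₘ z ::ₘ replicate p e) ::ₘ replicate p e)
        rw [hf.exchange x z _ _ (by simp) (by simp), cons_swap z y, cons_swap x] }
  refine ⟨I, rfl, ?_⟩
  -- Padding by copies of `e` up to arity `p + 2` makes induction on the multiset possible.
  have key : ∀ (s : Multiset X) (k : ℕ), card s + k = p + 2 →
      f (s + replicate k e) = s.prod := by
    intro s
    induction s using Multiset.induction with
    | empty =>
      intro k hk
      rw [card_zero, zero_add] at hk
      rw [hk, zero_add, hf.replicate_self, prod_zero]
      rfl
    | cons a s ih =>
      intro k hk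
      rw [card_cons] at hk
      rw [prod_cons, ← ih (k + 1) (by omega)]
      change _ = f (a ::ₘ f (s + replicate (k + 1) e) ::ₘ replicate p e)
      rw [cons_swap, replicate_succ, add_cons, hf.exchange e a _ _ (by simp; omega) (by simp),
        hone, cons_add]
  intro s hs
  rw [← key s 0 hs, replicate_zero, add_zero]

end IsMultisetForm

theorem map_update_const {e x : X} (i : Fin (p + 2)) :
    Finset.univ.val.map (Function.update (fun _ => e) i x) =
      x ::ₘ Multiset.replicate (p + 1) e := by
  classical
  rw [← Finset.insert_erase (Finset.mem_univ i),
    Finset.insert_val_of_notMem (Finset.notMem_erase _ _), Multiset.map_cons,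
    Function.update_self]
  congr 1
  rw [Multiset.eq_replicate]
  refine ⟨by simp, fun b hb => ?_⟩
  obtain ⟨j, hj, rfl⟩ := Multiset.mem_map.1 hb
  exact Function.update_of_ne ((Finset.mem_erase.1 (show j ∈ Finset.univ.erase i from hj)).1) _ _

theorem exists_isNeutral [Finite X] [Nonempty X] {F : NaryOp (p + 2) X}
    (hF : F ∈ aqsOps (p + 2) X) : ∃ e, F.IsNeutral e := by
  obtain ⟨f, hf, hFf⟩ := exists_isMultisetForm hF
  obtain ⟨e, he⟩ := hf.exists_neutral
  exact ⟨e, fun x i => by rw [hFf, map_update_const, he]⟩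

/-- Every associative quasitrivial symmetric operation with a neutral element comes from a
twisted chain. -/
theorem exists_eq_ofEquiv [Fintype X] {m : ℕ} (hX : Fintype.card X = m + 2)
    {F : NaryOp (p + 2) X} (hF : F ∈ aqsOps (p + 2) X) {e : X} (he : F.IsNeutral e) :
    ∃ t : Bool, (t = true → Odd (p + 2)) ∧
      ∃ σ : X ≃ TwistedChain t m, σ e = 1 ∧ F = ofEquiv (p + 2) σ := by
  have : Nonempty X := ⟨e⟩
  obtain ⟨f, hf, hFf⟩ := exists_isMultisetForm hF
  obtain ⟨I, rfl, hI⟩ := hf.exists_commMonoid (e := e) fun x => by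
    rw [← map_update_const 0, ← hFf, he x 0]
  have hprod : ∀ x, F x = ∏ i, x i := fun x => by
    rw [hFf, hI _ (by simp)]
    rfl
  obtain ⟨t, ht, ⟨σ⟩⟩ := exists_mulEquiv_twistedChain (p := p) hX fun x => hprod x ▸ hF.2.1 x
  refine ⟨t, ht, σ.toEquiv, map_one σ, funext fun x => ?_⟩
  rw [hprod, ofEquiv]
  exact (σ.symm_apply_apply _).symm.trans (congrArg σ.symm (map_prod σ _ _))

end NaryOp

/-! ### Counting -/

namespace NaryOp

variable {X : Type*} {p m : ℕ} {t : Bool}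

theorem ofEquiv_mem_aqsOps (ht : t = true → Odd (p + 2)) (σ : X ≃ TwistedChain t m) :
    ofEquiv (p + 2) σ ∈ aqsOps (p + 2) X :=
  ⟨isAssociative_ofEquiv σ,
    isQuasitrivial_ofEquiv σ (TwistedChain.prod_mem_range (by omega) ht), isSymmetric_ofEquiv σ⟩

theorem setOf_isNeutral_ofEquiv_false (σ : X ≃ TwistedChain false m) :
    {e | (ofEquiv (p + 2) σ).IsNeutral e} = {σ.symm 1} := by
  ext e
  rw [Set.mem_ofPred_eq, isNeutral_ofEquiv, Set.mem_singleton_iff, Equiv.eq_symm_apply]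
  refine ⟨fun h => ?_, fun h => by rw [h, one_pow]⟩
  simpa using TwistedChain.eq_one_of_pow_eq_one h

theorem setOf_isNeutral_ofEquiv_true (hp : Odd (p + 2)) (σ : X ≃ TwistedChain true m) :
    {e | (ofEquiv (p + 2) σ).IsNeutral e} = {σ.symm 1, σ.symm TwistedChain.second} := by
  ext e
  rw [Set.mem_ofPred_eq, isNeutral_ofEquiv, Set.mem_insert_iff, Set.mem_singleton_iff,
    Equiv.eq_symm_apply, Equiv.eq_symm_apply]
  constructor
  · intro h
    simpa using TwistedChain.eq_one_of_pow_eq_one h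
  · rintro (h | h)
    · rw [h, one_pow]
    · rw [h, TwistedChain.second_pow_even]
      obtain ⟨r, hr⟩ := hp
      exact ⟨r, by omega⟩

theorem ncard_isNeutral_ofEquiv (ht : t = true → Odd (p + 2)) (σ : X ≃ TwistedChain t m) :
    {e | (ofEquiv (p + 2) σ).IsNeutral e}.ncard = if t = true then 2 else 1 := by
  cases t
  · simp [setOf_isNeutral_ofEquiv_false]
  · rw [setOf_isNeutral_ofEquiv_true (ht rfl), Set.ncard_pair, if_pos rfl]
    rw [Ne, σ.symm.injective.eq_iff]
    exact TwistedChain.second_ne_one.symm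

theorem isNeutral_symm_one (σ : X ≃ TwistedChain t m) :
    (ofEquiv (p + 2) σ).IsNeutral (σ.symm 1) := by
  rw [isNeutral_ofEquiv, Equiv.apply_symm_apply, one_pow]

/-- `F` together with the unit determines the binary product, so `σ.symm` followed by `τ` is an
automorphism of the chain, hence trivial. -/
theorem ofEquiv_inj {σ τ : X ≃ TwistedChain t m}
    (h : ofEquiv (p + 2) σ = ofEquiv (p + 2) τ) (h1 : σ.symm 1 = τ.symm 1) : σ = τ := by
  have hmul : ∀ a b, σ.symm (σ a * σ b) = τ.symm (τ a * τ b) := fun a b => by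
    rw [← ofEquiv_cons_cons (p := p), ← ofEquiv_cons_cons (p := p), h, h1]
  let g : TwistedChain t m ≃* TwistedChain t m := MulEquiv.mk' (σ.symm.trans τ) fun a b => by
    have := hmul (σ.symm a) (σ.symm b)
    simp only [Equiv.apply_symm_apply] at this
    simp [this]
  ext x
  have := TwistedChain.mulEquiv_eq_refl g (σ x)
  change τ (σ.symm (σ x)) = σ x at this
  rw [← this, Equiv.symm_apply_apply]

theorem exists_eq_ofEquiv_of_ncard {F : NaryOp (p + 2) (Fin (m + 2))}
    (hF : F ∈ aqsOps (p + 2) (Fin (m + 2))) {e : Fin (m + 2)} (he : F.IsNeutral e) (t : Bool)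
    (hc : {e | F.IsNeutral e}.ncard = if t = true then 2 else 1) :
    ∃ σ : Fin (m + 2) ≃ TwistedChain t m, σ e = 1 ∧ F = ofEquiv (p + 2) σ := by
  obtain ⟨t', ht', σ, hσ, rfl⟩ := exists_eq_ofEquiv (Fintype.card_fin _) hF he
  rw [ncard_isNeutral_ofEquiv ht'] at hc
  obtain rfl : t' = t := by cases t <;> cases t' <;> simp_all
  exact ⟨σ, hσ, rfl⟩

theorem card_equiv_twistedChain (t : Bool) (m : ℕ) :
    Fintype.card (Fin (m + 2) ≃ TwistedChain t m) = (m + 2)! :=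
  (Fintype.card_equiv (Equiv.refl (Fin (m + 2)) : Fin (m + 2) ≃ TwistedChain t m)).trans
    (by rw [Fintype.card_fin])

theorem qsNeutral_one (p m : ℕ) : qsNeutral 1 (p + 2) (m + 2) = (m + 2)! := by
  have hS : {F ∈ aqsOps (p + 2) (Fin (m + 2)) | {e | F.IsNeutral e}.ncard = 1} =
      (fun σ : Fin (m + 2) ≃ TwistedChain false m => ofEquiv (p + 2) σ) '' Set.univ := by
    ext F
    constructor
    · rintro ⟨hF, hc⟩
      obtain ⟨e, he⟩ := exists_isNeutral hF
      obtain ⟨σ, -, rfl⟩ := exists_eq_ofEquiv_of_ncard hF he false hc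
      exact ⟨σ, trivial, rfl⟩
    · rintro ⟨σ, -, rfl⟩
      exact ⟨ofEquiv_mem_aqsOps (by simp) σ, ncard_isNeutral_ofEquiv (by simp) σ⟩
  rw [qsNeutral, hS, Set.ncard_image_of_injective, Set.ncard_univ, Nat.card_eq_fintype_card,
    card_equiv_twistedChain]
  intro σ τ h
  refine ofEquiv_inj h (Set.singleton_injective ?_)
  rw [← setOf_isNeutral_ofEquiv_false (p := p), ← setOf_isNeutral_ofEquiv_false (p := p)]
  exact congrArg (fun F : NaryOp (p + 2) (Fin (m + 2)) => {e | F.IsNeutral e}) h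

theorem two_mul_qsNeutral_two (p m : ℕ) (hp : Odd (p + 2)) :
    2 * qsNeutral 2 (p + 2) (m + 2) = (m + 2)! := by
  classical
  rw [← card_equiv_twistedChain true m, qsNeutral, Set.ncard_eq_toFinset_card', ← Finset.card_univ,
    Finset.card_eq_sum_card_fiberwise (f := fun σ => ofEquiv (p + 2) σ)
      (t := {F ∈ aqsOps (p + 2) (Fin (m + 2)) | {e | F.IsNeutral e}.ncard = 2}.toFinset)]
  -- The fibre over `F` is in bijection with its two neutral elements through `σ ↦ σ.symm 1`.
  · rw [Finset.sum_const_nat (m := 2), mul_comm]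
    intro F hF
    obtain ⟨hF, hc⟩ := Set.mem_toFinset.1 hF
    refine Eq.trans ?_ hc
    rw [← Set.ncard_coe_finset]
    refine Set.ncard_congr (fun σ _ => σ.symm 1) ?_ ?_ ?_
    · intro σ hσ
      obtain rfl : ofEquiv (p + 2) σ = F := by simpa using hσ
      exact isNeutral_symm_one σ
    · intro σ τ hσ hτ h
      obtain rfl : ofEquiv (p + 2) σ = F := by simpa using hσ
      exact ofEquiv_inj (by simpa using hτ : ofEquiv (p + 2) τ = ofEquiv (p + 2) σ).symm h
    · intro e he
      obtain ⟨σ, hσ, rfl⟩ := exists_eq_ofEquiv_of_ncard hF he true hc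
      exact ⟨σ, by simp, by rw [← hσ, Equiv.symm_apply_apply]⟩
  · intro σ _
    simp only [Set.coe_toFinset]
    exact ⟨ofEquiv_mem_aqsOps (fun _ => hp) σ, ncard_isNeutral_ofEquiv (fun _ => hp) σ⟩

theorem qs_eq_add (p m : ℕ) :
    qs (p + 2) (m + 2) = qsNeutral 1 (p + 2) (m + 2) + qsNeutral 2 (p + 2) (m + 2) := by
  rw [qs, qsNeutral, qsNeutral, ← Set.ncard_union_eq]
  · congr 1
    ext F
    refine ⟨fun hF => ?_, ?_⟩
    · obtain ⟨e, he⟩ := exists_isNeutral hF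
      obtain ⟨t, ht, σ, hσ, rfl⟩ := exists_eq_ofEquiv (Fintype.card_fin _) hF he
      have := ncard_isNeutral_ofEquiv ht σ
      cases t
      · exact Or.inl ⟨hF, this⟩
      · exact Or.inr ⟨hF, this⟩
    · rintro (h | h) <;> exact h.1
  · rw [Set.disjoint_left]
    rintro F ⟨-, h1⟩ ⟨-, h2⟩
    omega

theorem qsNeutral_two_of_even (p m : ℕ) (hp : Even (p + 2)) :
    qsNeutral 2 (p + 2) (m + 2) = 0 := by
  rw [qsNeutral, Set.ncard_eq_zero (Set.toFinite _), Set.eq_empty_iff_forall_notMem]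
  rintro F ⟨hF, hc⟩
  obtain ⟨e, he⟩ := exists_isNeutral hF
  obtain ⟨t, ht, σ, hσ, rfl⟩ := exists_eq_ofEquiv (Fintype.card_fin _) hF he
  rw [ncard_isNeutral_ofEquiv ht] at hc
  cases t
  · simp at hc
  · exact Nat.not_odd_iff_even.2 hp (ht rfl)

end NaryOp

theorem mainTheorem10 (n k : ℕ) (hn : 2 ≤ n) (hk : 2 ≤ k) :
    (NaryOp.qsNeutral 1 n k = NaryOp.qs 2 k ∧ NaryOp.qs 2 k = k !) ∧
    (Odd n →
      (NaryOp.qsNeutral 2 n k : ℚ) = (k ! : ℚ) / 2 ∧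
      (NaryOp.qs n k : ℚ) = 3 * (k ! : ℚ) / 2) := by
  obtain ⟨p, rfl⟩ := Nat.exists_eq_add_of_le' hn
  obtain ⟨m, rfl⟩ := Nat.exists_eq_add_of_le' hk
  have h2 : NaryOp.qs 2 (m + 2) = (m + 2)! := by
    have := NaryOp.qs_eq_add 0 m
    rwa [NaryOp.qsNeutral_one, NaryOp.qsNeutral_two_of_even 0 m even_two, add_zero] at this
  refine ⟨⟨by rw [h2, NaryOp.qsNeutral_one], h2⟩, fun hp => ?_⟩
  have h : (2 : ℚ) * NaryOp.qsNeutral 2 (p + 2) (m + 2) = (m + 2)! := by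
    exact_mod_cast NaryOp.two_mul_qsNeutral_two p m hp
  rw [NaryOp.qs_eq_add, NaryOp.qsNeutral_one, Nat.cast_add]
  constructor <;> linarith
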